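/- Let $(\Omega,\mathcal A,\mu)$ be a measure space, $1<p<\infty$, $\frac1p+\frac1q=1$, and $X=L^p(\Omega)$ (real valued), with $X^*$ identified with $L^q(\Omega)$ through $\langle f,g\rangle=\int_\Omega f g\,d\mu$. Let $y_1,\dots,y_m\in\{-1,1\}$, and let $K_1,\dots,K_m\subset X$ be nonempty, convex and weakly compact sets such that $K_+\cap K_-=\emptyset$, where $K_\pm$ is the convex hull of $\bigcup_{i:\,y_i=\pm1}K_i$. Consider the robust SVM problem $$\text{(R-SVM)}\qquad \min_{(w,b)\in X^*\times\mathbb R}\ \tfrac12\|w\|^2\quad\text{s.t.}\quad \min_{x_i\in K_i}y_i(\langle x_i,w\rangle+b)\ge 1,\quad i=1,\dots,m .$$ For $s\in L^p(\Omega)$ put $$J(s)=\frac{|s|^{p-1}\,\mathrm{sign}(s)}{\|s\|^{p-2}}\quad (s\neq0),\qquad J(0)=0 .$$ Then: 1. (R-SVM) has a solution $(\bar w,\bar b)$, and $\bar w$ is unique. 2. A pair $(\bar w,\bar b)\in X^*\times\mathbb R$ is a solution of (R-SVM) if and only if there exist $\bar\lambda\in\mathbb R_+^m$ and $\bar x_i\in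 K_i$ ($i=1,\dots,m$) such that $(\bar w,\bar b)$ is feasible for (R-SVM), $\sum_{i=1}^m y_i\bar\lambda_i=0$, $\bar\lambda_i\bigl(1-y_i(\langle\bar x_i,\bar w\rangle+\bar b)\bigr)=0$ for every $i$, and $$\bar w=J\Bigl(\sum_{i=1}^m y_i\bar\lambda_i\bar x_i\Bigr)=\frac{\bigl|\sum_{i} y_i\bar\lambda_i\bar x_i\bigr|^{p-1}\,\mathrm{sign}\bigl(\sum_{i} y_i\bar\lambda_i\bar x_i\bigr)}{\bigl\|\sum_{i} y_i\bar\lambda_i\bar x_i\bigr\|^{p-2}}\in L^q(\Omega)$$ (equality in $L^q(\Omega)$; the right-hand side is $0$ if the sum is $0$). 3. $J$ is the duality map of $L^p(\Omega)$, which is single-valued: for every $s\in L^p(\Omega)$ the function $J(s)$ belongs to $L^q(\Omega)$ and $\{x^*\in X^*:\langle s,x^*\rangle=\|s\|^2=\|x^*\|^2\}=\{J(s)\}$. -/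

import Mathlib

open MeasureTheory
open scoped ENNReal

section Banach

variable {X : Type*} [NormedAddCommGroup X] [NormedSpace ℝ X] {m : ℕ}

/-- A set is weakly compact if it is compact in the weak topology `σ(X, X*)`. -/
def IsWeaklyCompact (K : Set X) : Prop :=
  IsCompact (toWeakSpace ℝ X '' K)

/-- The convex hull of the union of the uncertainty sets `K i` carrying the label `c`. -/
def classHull (K : Fin m → Set X) (y : Fin m → ℝ) (c : ℝ) : Set X :=
  convexHull ℝ (⋃ i ∈ {i | y i = c}, K i)

/-- The constraints of the robust SVM problem: `min_{x ∈ K i} y i * (⟨x, w⟩ + b) ≥ 1`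
for every `i`. -/
def RSVMFeasible (K : Fin m → Set X) (y : Fin m → ℝ) (w : StrongDual ℝ X) (b : ℝ) : Prop :=
  ∀ i, ∀ x ∈ K i, 1 ≤ y i * (w x + b)

/-- `(w, b)` is a minimizer of `½ ‖w‖²` over `X* × ℝ` under the robust SVM constraints. -/
def IsRSVMSolution (K : Fin m → Set X) (y : Fin m → ℝ) (w : StrongDual ℝ X) (b : ℝ) : Prop :=
  RSVMFeasible K y w b ∧
    ∀ (w' : StrongDual ℝ X) (b' : ℝ), RSVMFeasible K y w' b' →
      (1 / 2 : ℝ) * ‖w‖ ^ 2 ≤ (1 / 2 : ℝ) * ‖w'‖ ^ 2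

/-- `lam ∈ ℝ₊^m` and `x ∈ ∏ K i` satisfy, together with `(w, b)`, the feasibility, balance and
complementarity conditions of the robust SVM problem. The remaining optimality condition, which
expresses `w` through `∑ i, (y i * lam i) • x i`, is not part of this definition. -/
structure RSVMMultipliers (K : Fin m → Set X) (y : Fin m → ℝ) (w : StrongDual ℝ X) (b : ℝ)
    (lam : Fin m → ℝ) (x : Fin m → X) : Prop where
  nonneg : ∀ i, 0 ≤ lam i
  mem : ∀ i, x i ∈ K i
  feasible : RSVMFeasible K y w b
  balance : ∑ i, y i * lam i = 0
  complementarity : ∀ i, lam i * (1 - y i * (w (x i) + b)) = 0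

/-- The normalized duality mapping `M(x) = {φ ∈ X* : ⟨x, φ⟩ = ‖x‖² = ‖φ‖²}`. -/
def dualityMap (x : X) : Set (StrongDual ℝ X) :=
  {φ | φ x = ‖x‖ ^ 2 ∧ ‖x‖ ^ 2 = ‖φ‖ ^ 2}

end Banach

section Lp

variable {Ω : Type*} [MeasurableSpace Ω] {μ : Measure Ω}

/-- The function `|s|^(p-1) sign(s) / ‖s‖^(p-2)` (identically `0` for `s = 0`). -/
noncomputable def lpDualityFun {p : ℝ≥0∞} (s : Lp ℝ p μ) : Ω → ℝ :=
  fun t => |s t| ^ (p.toReal - 1) * Real.sign (s t) / ‖s‖ ^ (p.toReal - 2)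

/-- `w ∈ (L^p)*` equals `h` under the identification of `(L^p)*` with `L^q`: `h` lies in `L^q`,
`w` is integration against `h`, and any function of `L^q` that represents `w` equals `h` a.e. -/
def IsLqRepresentation {p : ℝ≥0∞} [Fact (1 ≤ p)] (q : ℝ≥0∞)
    (w : StrongDual ℝ (Lp ℝ p μ)) (h : Ω → ℝ) : Prop :=
  MemLp h q μ ∧ (∀ f : Lp ℝ p μ, w f = ∫ t, f t * h t ∂μ) ∧
    ∀ g : Ω → ℝ, MemLp g q μ → (∀ f : Lp ℝ p μ, w f = ∫ t, f t * g t ∂μ) → g =ᵐ[μ] h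

end Lp

/-! ### Least-norm points and their supporting functionals -/

section Banach

variable {X : Type*} [NormedAddCommGroup X] [NormedSpace ℝ X] {m : ℕ}

/-! The problem is dual to finding the distance between `K_+` and `K_-`. If both labels occur, the
differences of hull points form a convex, weakly compact set that misses `0`, so it has a nonzero
element `z` of least norm, and Hahn-Banach gives `w ≥ 2` on the set with `‖w‖ * ‖z‖ ≤ 2`
(`exists_optimal_dual`). Writing `s = (2 / ‖z‖ ^ 2) • z` as `∑ i, (y i * lam i) • x i`, one has `‖s‖
^ 2 = ∑ i, lam i`, and weak duality gives `‖s‖ ^ 2 ≤ w' s ≤ ‖w'‖ * ‖s‖` for every feasible `w'`. So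
`w` is optimal, and equality in this chain puts every solution into `dualityMap s` for one common
`s`.

In `L^p`, if `φ ∈ dualityMap s`, then `‖s‖^p * ‖s + r f‖^p - |φ (s + r f)|^p` is minimal at `r = 0`.
Its vanishing derivative says that `φ` is integration against `J(s)`
(`apply_eq_integral_of_mem_dualityMap`). This yields uniqueness and the formula for an arbitrary
measure, with no appeal to the Riesz representation of the dual. -/

theorem lowerSemicontinuous_norm_toWeakSpace_symm :
    LowerSemicontinuous fun x : WeakSpace ℝ X => ‖(toWeakSpace ℝ X).symm x‖ := by
  rw [lowerSemicontinuous_iff_isClosed_preimage]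
  intro r
  have h : (fun x : WeakSpace ℝ X => ‖(toWeakSpace ℝ X).symm x‖) ⁻¹' Set.Iic r =
      toWeakSpace ℝ X '' Metric.closedBall 0 r := by
    rw [LinearEquiv.image_eq_preimage_symm]
    ext x
    simp
  -- Mazur: a convex norm-closed set is weakly closed.
  rw [h, ← Metric.isClosed_closedBall.closure_eq,
    (convex_closedBall (0 : X) r).toWeakSpace_closure ℝ]
  exact isClosed_closure

/-- A nonempty weakly compact set contains an element of least norm. -/
theorem IsWeaklyCompact.exists_norm_le {C : Set X} (hC : IsWeaklyCompact C) (hne : C.Nonempty) :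
    ∃ x ∈ C, ∀ z ∈ C, ‖x‖ ≤ ‖z‖ := by
  obtain ⟨x', ⟨x, hx, rfl⟩, hmin⟩ :=
    (lowerSemicontinuous_norm_toWeakSpace_symm (X := X)).lowerSemicontinuousOn
      (toWeakSpace ℝ X '' C) |>.exists_isMinOn (hne.image _) hC
  refine ⟨x, hx, fun z hz => ?_⟩
  simpa using hmin (Set.mem_image_of_mem _ hz)

/-- A nonzero element `x` of least norm of a convex set `C` is supported by a functional. -/
theorem exists_dual_of_forall_norm_le {C : Set X} (hC : Convex ℝ C) {x : X} (hx0 : x ≠ 0)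
    (hmin : ∀ z ∈ C, ‖x‖ ≤ ‖z‖) :
    ∃ w : StrongDual ℝ X, (∀ z ∈ C, 2 ≤ w z) ∧ ‖w‖ * ‖x‖ ≤ 2 := by
  have hxpos : 0 < ‖x‖ := norm_pos_iff.mpr hx0
  obtain ⟨f, u, hball, hfC⟩ := geometric_hahn_banach_open (convex_ball (0 : X) ‖x‖)
    Metric.isOpen_ball hC (Set.disjoint_left.mpr fun z hz hzC => by
      have := hmin z hzC
      rw [mem_ball_zero_iff] at hz
      linarith)
  have hu : 0 < u := by simpa using hball 0 (by simpa using hx0)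
  have hclosed : ∀ a ∈ Metric.closedBall (0 : X) ‖x‖, f a ≤ u := by
    intro a ha
    rw [← closure_ball (0 : X) hxpos.ne'] at ha
    exact closure_minimal (fun a ha => (hball a ha).le)
      (isClosed_le f.continuous continuous_const) ha
  have hnorm : ‖f‖ * ‖x‖ ≤ u := by
    rw [← le_div_iff₀ hxpos]
    refine f.opNorm_le_of_unit_norm (by positivity) fun v hv => ?_
    rw [le_div_iff₀ hxpos, Real.norm_eq_abs]
    have h1 := hclosed (‖x‖ • v) (by simp [norm_smul, hv])
    have h2 := hclosed (-(‖x‖ • v)) (by simp [norm_smul, hv])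
    simp only [map_neg, map_smul, smul_eq_mul] at h1 h2
    rcases abs_cases (f v) with ⟨h, -⟩ | ⟨h, -⟩ <;> rw [h] <;> linarith
  -- The level `u` is rescaled to `2`, the gap between the margins `1` and `-1`.
  refine ⟨(2 / u) • f, fun z hz => ?_, ?_⟩
  · have := hfC z hz
    simp only [smul_apply, smul_eq_mul]
    rw [div_mul_eq_mul_div, le_div_iff₀ hu]
    linarith
  · rw [norm_smul, Real.norm_of_nonneg (by positivity), mul_assoc, div_mul_eq_mul_div,
      div_le_iff₀ hu]
    linarith

/-! ### The set of differences of the two class hulls -/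

/-- The weights `a ≥ 0` of total mass `2` which are balanced between the two classes. -/
def balancedWeights (y : Fin m → ℝ) : Set (Fin m → ℝ) :=
  {a | (∀ i, 0 ≤ a i) ∧ ∑ i, a i = 2 ∧ ∑ i, y i * a i = 0}

theorem isCompact_balancedWeights (y : Fin m → ℝ) : IsCompact (balancedWeights y) := by
  refine (isCompact_univ_pi fun _ : Fin m => isCompact_Icc (a := (0 : ℝ)) (b := 2)).of_isClosed_subset
    ?_ fun a ha i _ => ⟨ha.1 i, ?_⟩
  · refine IsClosed.inter ?_ (IsClosed.inter ?_ ?_)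
    · exact isClosed_le (f := fun _ : Fin m → ℝ => (0 : Fin m → ℝ)) continuous_const continuous_id
    · exact isClosed_eq (by fun_prop) continuous_const
    · exact isClosed_eq (by fun_prop) continuous_const
  · rw [← ha.2.1]
    exact Finset.single_le_sum (fun j _ => ha.1 j) (Finset.mem_univ i)

/-- The differences `u - v` of points `u`, `v` of the convex hulls of the two classes. -/
def classDifference (K : Fin m → Set X) (y : Fin m → ℝ) : Set X :=
  {z | ∃ a ∈ balancedWeights y, ∃ x : Fin m → X, (∀ i, x i ∈ K i) ∧ ∑ i, (y i * a i) • x i = z}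

/-- Parametrizing by weights and one point per `K i` exhibits the set as a continuous image of a
compact product, so no closure of a hull is needed. -/
theorem isWeaklyCompact_classDifference {K : Fin m → Set X} (hK : ∀ i, IsWeaklyCompact (K i))
    (y : Fin m → ℝ) : IsWeaklyCompact (classDifference K y) := by
  have hT := (isCompact_balancedWeights y).prod (isCompact_univ_pi hK)
  let F : (Fin m → ℝ) × (Fin m → WeakSpace ℝ X) → WeakSpace ℝ X :=
    fun t => ∑ i, (y i * t.1 i) • t.2 i
  have hF : Continuous F := by
    refine continuous_finsetSum _ fun i _ => ?_
    exact Continuous.smul (by fun_prop) (by fun_prop)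
  have := hT.image hF
  unfold IsWeaklyCompact
  convert this using 1
  ext z
  constructor
  · rintro ⟨_, ⟨a, ha, x, hx, rfl⟩, rfl⟩
    refine ⟨(a, fun i => toWeakSpace ℝ X (x i)), ⟨ha, fun i _ => ⟨x i, hx i, rfl⟩⟩, ?_⟩
    simp [F]
  · rintro ⟨⟨a, x⟩, ⟨ha, hx⟩, rfl⟩
    choose x' hx' hxx using fun i => hx i (Set.mem_univ i)
    refine ⟨_, ⟨a, ha, x', hx', rfl⟩, ?_⟩
    simp [F, hxx]

theorem convex_classDifference {K : Fin m → Set X} (hK : ∀ i, Convex ℝ (K i)) (y : Fin m → ℝ) :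
    Convex ℝ (classDifference K y) := by
  rintro _ ⟨a, ha, x, hx, rfl⟩ _ ⟨b, hb, z, hz, rfl⟩ s t hs ht hst
  -- Convexity of `K i` merges two weighted points into one, even when both weights vanish.
  choose u hu hux using fun i => (hK i).exists_mem_add_smul_eq (hx i) (hz i)
    (mul_nonneg hs (ha.1 i)) (mul_nonneg ht (hb.1 i))
  refine ⟨fun i => s * a i + t * b i, ⟨fun i => ?_, ?_, ?_⟩, u, hu, ?_⟩
  · exact add_nonneg (mul_nonneg hs (ha.1 i)) (mul_nonneg ht (hb.1 i))
  · rw [Finset.sum_add_distrib, ← Finset.mul_sum, ← Finset.mul_sum, ha.2.1, hb.2.1]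
    linear_combination 2 * hst
  · have : ∀ i, y i * (s * a i + t * b i) = s * (y i * a i) + t * (y i * b i) := fun i => by ring
    simp only [this]
    rw [Finset.sum_add_distrib, ← Finset.mul_sum, ← Finset.mul_sum, ha.2.2, hb.2.2]
    simp
  · rw [Finset.smul_sum, Finset.smul_sum, ← Finset.sum_add_distrib]
    refine Finset.sum_congr rfl fun i _ => ?_
    rw [mul_smul, hux i, smul_add, smul_smul, smul_smul, smul_smul, smul_smul]
    congr 2 <;> ring

theorem sum_filter_smul_mem_classHull {K : Fin m → Set X} {y : Fin m → ℝ} {c : ℝ}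
    {a : Fin m → ℝ} {x : Fin m → X} (ha : ∀ i, 0 ≤ a i) (hx : ∀ i, x i ∈ K i)
    (h1 : ∑ i with y i = c, a i = 1) : ∑ i with y i = c, a i • x i ∈ classHull K y c :=
  (convex_convexHull ℝ _).sum_mem (fun i _ => ha i) h1 fun i hi =>
    subset_convexHull ℝ _ (Set.mem_biUnion (Finset.mem_filter.mp hi).2 (hx i))

theorem filter_label_ne_one {y : Fin m → ℝ} (hy : ∀ i, y i = 1 ∨ y i = -1) :
    (Finset.univ.filter fun i => ¬ y i = 1) = Finset.univ.filter fun i => y i = -1 := by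
  refine Finset.filter_congr fun i _ => ?_
  rcases hy i with h | h <;> rw [h] <;> norm_num

theorem sum_label_smul_eq_sub {M : Type*} [AddCommGroup M] [Module ℝ M] {y : Fin m → ℝ}
    (hy : ∀ i, y i = 1 ∨ y i = -1) (a : Fin m → ℝ) (v : Fin m → M) :
    ∑ i, (y i * a i) • v i = ∑ i with y i = 1, a i • v i - ∑ i with y i = -1, a i • v i := by
  rw [← Finset.sum_filter_add_sum_filter_not _ (fun i => y i = 1), filter_label_ne_one hy,
    sub_eq_add_neg, ← Finset.sum_neg_distrib]
  congr 1 <;> refine Finset.sum_congr rfl fun i hi => ?_ <;>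
    rw [(Finset.mem_filter.mp hi).2] <;> simp

/-- Balance and total mass `2` give each class mass `1`; a vanishing difference would thus be a
common point of the hulls. -/
theorem zero_notMem_classDifference {K : Fin m → Set X} {y : Fin m → ℝ}
    (hy : ∀ i, y i = 1 ∨ y i = -1) (hK : classHull K y 1 ∩ classHull K y (-1) = ∅) :
    (0 : X) ∉ classDifference K y := by
  rintro ⟨a, ⟨ha, ha2, ha0⟩, x, hx, h0⟩
  have hs := sum_label_smul_eq_sub hy a fun _ => (1 : ℝ)
  have ht := Finset.sum_filter_add_sum_filter_not Finset.univ (fun i => y i = 1) a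
  rw [filter_label_ne_one hy, ha2] at ht
  simp only [smul_eq_mul, mul_one, ha0] at hs
  have hpos := sum_filter_smul_mem_classHull ha hx (c := 1) (y := y) (by linarith)
  have hmin := sum_filter_smul_mem_classHull ha hx (c := -1) (y := y) (by linarith)
  rw [sum_label_smul_eq_sub hy a x, sub_eq_zero] at h0
  rw [← h0] at hmin
  exact Set.eq_empty_iff_forall_notMem.mp hK _ ⟨hpos, hmin⟩

theorem sub_mem_classDifference {K : Fin m → Set X} {y : Fin m → ℝ}
    (hne : ∀ i, (K i).Nonempty) {i j : Fin m} (hi : y i = 1) (hj : y j = -1)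
    {u v : X} (hu : u ∈ K i) (hv : v ∈ K j) : u - v ∈ classDifference K y := by
  have hij : i ≠ j := by
    rintro rfl
    norm_num [hi] at hj
  choose x hx using hne
  -- The other indices have weight `0`, so any points of their sets will do.
  refine ⟨Pi.single i 1 + Pi.single j 1, ⟨fun k => ?_, ?_, ?_⟩,
    Function.update (Function.update x i u) j v, fun k => ?_, ?_⟩
  · simp only [Pi.add_apply, Pi.single_apply]
    split_ifs <;> norm_num
  · simp [Finset.sum_add_distrib]
    norm_num
  · simp [mul_add, Finset.sum_add_distrib, Pi.single_apply, hi, hj]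
  · rcases eq_or_ne k j with rfl | hkj
    · simpa using hv
    · rcases eq_or_ne k i with rfl | hki
      · simpa [hkj] using hu
      · simpa [hkj, hki] using hx k
  · simp [mul_add, add_smul, Finset.sum_add_distrib, Pi.single_apply, ite_smul, hi, hj, hij,
      sub_eq_add_neg]

/-! ### Duality and optimality conditions -/

/-- Weak duality for the robust SVM problem. -/
theorem RSVMFeasible.sum_le {K : Fin m → Set X} {y : Fin m → ℝ} {w : StrongDual ℝ X} {b : ℝ}
    (hw : RSVMFeasible K y w b) {lam : Fin m → ℝ} {x : Fin m → X} (hlam : ∀ i, 0 ≤ lam i)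
    (hx : ∀ i, x i ∈ K i) : ∑ i, lam i ≤ ∑ i, lam i * (y i * (w (x i) + b)) :=
  Finset.sum_le_sum fun i _ => le_mul_of_one_le_right (hlam i) (hw i _ (hx i))

/-- Balance of the multipliers eliminates the offset `b`. -/
theorem sum_mul_margin_eq {y : Fin m → ℝ} (w : StrongDual ℝ X) (b : ℝ)
    {lam : Fin m → ℝ} (hbal : ∑ i, y i * lam i = 0) (x : Fin m → X) :
    ∑ i, lam i * (y i * (w (x i) + b)) = w (∑ i, (y i * lam i) • x i) := by
  have h : ∀ i, lam i * (y i * (w (x i) + b)) = y i * lam i * w (x i) + y i * lam i * b :=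
    fun i => by ring
  simp only [h, Finset.sum_add_distrib, ← Finset.sum_mul, hbal, map_sum, map_smul, smul_eq_mul,
    zero_mul, add_zero]

/-- Complementarity turns weak duality into an equality for `w`, so `‖w‖ ^ 2 = w s = ∑ i, lam i ≤ w'
s ≤ ‖w'‖ * ‖s‖` with `‖s‖ = ‖w‖`. -/
theorem RSVMMultipliers.isRSVMSolution {K : Fin m → Set X} {y : Fin m → ℝ}
    {w : StrongDual ℝ X} {b : ℝ} {lam : Fin m → ℝ} {x : Fin m → X}
    (h : RSVMMultipliers K y w b lam x) (hw : w ∈ dualityMap (∑ i, (y i * lam i) • x i)) :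
    IsRSVMSolution K y w b := by
  refine ⟨h.feasible, fun w' b' hw' => ?_⟩
  set s := ∑ i, (y i * lam i) • x i with hs
  have h1 : ∑ i, lam i = w s := by
    rw [hs, ← sum_mul_margin_eq w b h.balance]
    exact Finset.sum_congr rfl fun i _ => by linarith [h.complementarity i]
  have h2 : ∑ i, lam i ≤ w' s := by
    rw [hs, ← sum_mul_margin_eq w' b' h.balance]
    exact hw'.sum_le h.nonneg h.mem
  have h3 : w' s ≤ ‖w'‖ * ‖s‖ := (le_abs_self _).trans (w'.le_opNorm s)
  have h4 := hw.1
  have h5 := hw.2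
  nlinarith [sq_nonneg (‖w'‖ - ‖s‖)]

/-- Optimal dual data `lam`, `x` together with an optimal pair `(w, b)`. -/
theorem exists_optimal_dual {K : Fin m → Set X} {y : Fin m → ℝ}
    (hy : ∀ i, y i = 1 ∨ y i = -1) (hne : ∀ i, (K i).Nonempty)
    (hconv : ∀ i, Convex ℝ (K i)) (hcpt : ∀ i, IsWeaklyCompact (K i))
    (hdisj : classHull K y 1 ∩ classHull K y (-1) = ∅) :
    ∃ (lam : Fin m → ℝ) (x : Fin m → X) (w : StrongDual ℝ X) (b : ℝ),
      (∀ i, 0 ≤ lam i) ∧ (∀ i, x i ∈ K i) ∧ ∑ i, y i * lam i = 0 ∧ RSVMFeasible K y w b ∧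
      ‖w‖ ≤ ‖∑ i, (y i * lam i) • x i‖ ∧ ‖∑ i, (y i * lam i) • x i‖ ^ 2 = ∑ i, lam i := by
  by_cases hboth : (∃ i, y i = 1) ∧ ∃ j, y j = -1
  · obtain ⟨⟨i₀, hi₀⟩, j₀, hj₀⟩ := hboth
    obtain ⟨u₀, hu₀⟩ := hne i₀
    obtain ⟨v₀, hv₀⟩ := hne j₀
    obtain ⟨z, hz, hmin⟩ := (isWeaklyCompact_classDifference hcpt y).exists_norm_le
      ⟨_, sub_mem_classDifference hne hi₀ hj₀ hu₀ hv₀⟩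
    have hz0 : z ≠ 0 := fun h => zero_notMem_classDifference hy hdisj (h ▸ hz)
    have hzpos : 0 < ‖z‖ := norm_pos_iff.mpr hz0
    obtain ⟨w, hw, hwz⟩ := exists_dual_of_forall_norm_le (convex_classDifference hconv y) hz0 hmin
    obtain ⟨a, ⟨ha, ha2, ha0⟩, x, hx, hxz⟩ := hz
    have hsum : ∑ i, (y i * (2 / ‖z‖ ^ 2 * a i)) • x i = (2 / ‖z‖ ^ 2) • z := by
      rw [← hxz, Finset.smul_sum]
      refine Finset.sum_congr rfl fun i _ => ?_
      rw [smul_smul]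
      congr 1
      ring
    have hnorm : ‖(2 / ‖z‖ ^ 2) • z‖ = 2 / ‖z‖ := by
      rw [norm_smul, Real.norm_of_nonneg (by positivity)]
      field_simp
    have hsep : ∀ i, y i = 1 → ∀ u ∈ K i, ∀ j, y j = -1 → ∀ v ∈ K j, w v + 2 ≤ w u := by
      intro i hi u hu j hj v hv
      have := hw _ (sub_mem_classDifference hne hi hj hu hv)
      rw [map_sub] at this
      linarith
    let S : Set ℝ := {r | ∃ i, y i = 1 ∧ ∃ u ∈ K i, w u = r}
    have hSne : S.Nonempty := ⟨_, i₀, hi₀, u₀, hu₀, rfl⟩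
    have hSlow : ∀ j, y j = -1 → ∀ v ∈ K j, w v + 2 ∈ lowerBounds S := by
      rintro j hj v hv _ ⟨i, hi, u, hu, rfl⟩
      exact hsep i hi u hu j hj v hv
    -- The factor makes both `‖s‖ ^ 2` and `∑ i, lam i` equal to `4 / ‖z‖ ^ 2`. The offset puts the
    -- infimum of the positive class at margin `1`; the gap `2` then pushes the negative class below
    -- `-1`.
    refine ⟨fun i => 2 / ‖z‖ ^ 2 * a i, x, w, 1 - sInf S, fun i => ?_, hx, ?_, fun i v hv => ?_,
      ?_, ?_⟩
    · exact mul_nonneg (by positivity) (ha i)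
    · have : ∀ i, y i * (2 / ‖z‖ ^ 2 * a i) = 2 / ‖z‖ ^ 2 * (y i * a i) := fun i => by ring
      simp only [this, ← Finset.mul_sum, ha0, mul_zero]
    · rcases hy i with hi | hi
      · have : sInf S ≤ w v := csInf_le ⟨_, hSlow j₀ hj₀ v₀ hv₀⟩ ⟨i, hi, v, hv, rfl⟩
        rw [hi]
        linarith
      · have : w v + 2 ≤ sInf S := le_csInf hSne (hSlow i hi v hv)
        rw [hi]
        linarith
    · rw [hsum, hnorm, le_div_iff₀ hzpos]
      exact hwz
    · rw [hsum, hnorm, ← Finset.mul_sum, ha2]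
      ring
  -- If a label is missing, a constant classifier is feasible and everything else is `0`.
  · choose x hx using hne
    have hb : ∃ b : ℝ, ∀ i, 1 ≤ y i * b := by
      rw [not_and_or] at hboth
      push Not at hboth
      rcases hboth with h | h
      · exact ⟨-1, fun i => by norm_num [(hy i).resolve_left (h i)]⟩
      · exact ⟨1, fun i => by norm_num [(hy i).resolve_right (h i)]⟩
    obtain ⟨b, hb⟩ := hb
    exact ⟨0, x, 0, b, by simp, hx, by simp, fun i v _ => by simpa using hb i, by simp, by simp⟩

/-- The robust SVM problem is solvable, and a single choice of dual data `lam`, `x` provides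
multipliers for all of its solutions. -/
theorem exists_isRSVMSolution_and_multipliers {K : Fin m → Set X} {y : Fin m → ℝ}
    (hy : ∀ i, y i = 1 ∨ y i = -1) (hne : ∀ i, (K i).Nonempty)
    (hconv : ∀ i, Convex ℝ (K i)) (hcpt : ∀ i, IsWeaklyCompact (K i))
    (hdisj : classHull K y 1 ∩ classHull K y (-1) = ∅) :
    (∃ (w : StrongDual ℝ X) (b : ℝ), IsRSVMSolution K y w b) ∧
    ∃ (lam : Fin m → ℝ) (x : Fin m → X), ∀ (w : StrongDual ℝ X) (b : ℝ),
      IsRSVMSolution K y w b →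
        RSVMMultipliers K y w b lam x ∧ w ∈ dualityMap (∑ i, (y i * lam i) • x i) := by
  obtain ⟨lam, x, w₀, b₀, hlam, hx, hbal, hfeas, hnorm, hsq⟩ :=
    exists_optimal_dual hy hne hconv hcpt hdisj
  set s := ∑ i, (y i * lam i) • x i with hs
  have hval : ∀ (w : StrongDual ℝ X) (b : ℝ), RSVMFeasible K y w b → ‖s‖ ^ 2 ≤ w s := by
    intro w b hw
    rw [hsq, hs, ← sum_mul_margin_eq w b hbal]
    exact hw.sum_le hlam hx
  have hle : ∀ w : StrongDual ℝ X, w s ≤ ‖w‖ * ‖s‖ := fun w =>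
    (le_abs_self _).trans (w.le_opNorm s)
  have hlower : ∀ (w : StrongDual ℝ X) (b : ℝ), RSVMFeasible K y w b → ‖s‖ ≤ ‖w‖ := by
    intro w b hw
    rcases (norm_nonneg s).eq_or_lt with h | h
    · rw [← h]
      exact norm_nonneg w
    · refine le_of_mul_le_mul_right ?_ h
      rw [← sq]
      exact (hval w b hw).trans (hle w)
  refine ⟨⟨w₀, b₀, hfeas, fun w b hw => ?_⟩, lam, x, fun w b hw => ?_⟩
  · have := hnorm.trans (hlower w b hw)
    gcongr
  · have h1 : ‖w‖ ≤ ‖s‖ := by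
      have := hw.2 w₀ b₀ hfeas
      refine (abs_le_of_sq_le_sq' (by linarith) (norm_nonneg _) |>.2).trans hnorm
    have h2 : ‖w‖ = ‖s‖ := le_antisymm h1 (hlower w b hw.1)
    have h3 : w s = ‖s‖ ^ 2 := by
      refine le_antisymm ?_ (hval w b hw.1)
      have := hle w
      rwa [h2, ← sq] at this
    refine ⟨⟨hlam, hx, hw.1, hbal, fun i => ?_⟩, h3, by rw [h2]⟩
    -- Each term is nonpositive by feasibility, so a zero sum forces each one to vanish.
    have h4 : ∑ i, lam i * (1 - y i * (w (x i) + b)) = 0 := by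
      simp only [mul_sub, mul_one, Finset.sum_sub_distrib]
      rw [sum_mul_margin_eq w b hbal, ← hs, h3, hsq, sub_self]
    exact (Finset.sum_eq_zero_iff_of_nonpos fun i _ => mul_nonpos_of_nonneg_of_nonpos (hlam i)
      (by linarith [hw.1 i _ (hx i)])).mp h4 i (Finset.mem_univ i)

end Banach

/-! ### The duality map of `L^p` -/

section Lp

variable {Ω : Type*} [MeasurableSpace Ω] {μ : Measure Ω}

/-- The right-hand form is the one that differentiating `|x| ^ r` produces. At `x = 0` both sides
vanish for every `r`, whatever the value of the power. -/
theorem abs_rpow_mul_sign {r : ℝ} (x : ℝ) :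
    |x| ^ (r - 1) * Real.sign x = |x| ^ (r - 2) * x := by
  rcases lt_trichotomy x 0 with hx | rfl | hx
  · have h : |x| ^ (r - 1) = |x| ^ (r - 2) * |x| := by
      rw [← Real.rpow_add_one (abs_pos.mpr hx.ne).ne']
      congr 1
      ring
    rw [h, Real.sign_of_neg hx, abs_of_neg hx]
    ring
  · simp
  · have h : |x| ^ (r - 1) = |x| ^ (r - 2) * |x| := by
      rw [← Real.rpow_add_one (abs_pos.mpr hx.ne').ne']
      congr 1
      ring
    rw [h, Real.sign_of_pos hx, abs_of_pos hx]
    ring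

theorem abs_abs_rpow_mul_self {r : ℝ} (hr : 1 < r) (x : ℝ) :
    |(|x| ^ (r - 2) * x)| = |x| ^ (r - 1) := by
  rcases eq_or_ne x 0 with rfl | hx
  · simp [Real.zero_rpow (sub_pos.mpr hr).ne']
  · rw [abs_mul, abs_of_nonneg (by positivity), ← Real.rpow_add_one (abs_pos.mpr hx).ne']
    congr 1
    ring

theorem abs_rpow_mul_self_mul_self {r : ℝ} (hr : r ≠ 0) (x : ℝ) :
    |x| ^ (r - 2) * x * x = |x| ^ r := by
  rcases eq_or_ne x 0 with rfl | hx
  · simp [Real.zero_rpow hr]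
  · rw [mul_assoc, ← sq, ← sq_abs, ← Real.rpow_natCast, ← Real.rpow_add (abs_pos.mpr hx)]
    congr 1
    norm_num

/-- For conjugate exponents, `h ↦ |h| ^ (p - 2) * h` maps `L^p` to `L^q`. -/
theorem MeasureTheory.MemLp.abs_rpow_mul_self {p q : ℝ≥0∞} (hp : p ≠ ∞) (hq : q ≠ ∞)
    [ENNReal.HolderConjugate p q] {h : Ω → ℝ} (hh : MemLp h p μ) :
    MemLp (fun t => |h t| ^ (p.toReal - 2) * h t) q μ := by
  have hPQ := ENNReal.HolderConjugate.toReal_of_ne_top hp hq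
  have hmeas : AEStronglyMeasurable (fun t => |h t| ^ (p.toReal - 2) * h t) μ :=
    ((hh.1.aemeasurable.abs.pow_const _).mul hh.1.aemeasurable).aestronglyMeasurable
  rw [← integrable_norm_rpow_iff hmeas (ENNReal.HolderConjugate.ne_zero q p) hq]
  have := hh.integrable_norm_rpow (ENNReal.HolderConjugate.ne_zero p q) hp
  refine this.congr (Filter.Eventually.of_forall fun t => ?_)
  simp only [Real.norm_eq_abs]
  rw [abs_abs_rpow_mul_self hPQ.lt, ← Real.rpow_mul (abs_nonneg _), hPQ.sub_one_mul_conj]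

theorem Lp.norm_rpow_eq_integral {p : ℝ≥0∞} (hp0 : p ≠ 0) (hp : p ≠ ∞) (s : Lp ℝ p μ) :
    ‖s‖ ^ p.toReal = ∫ t, |s t| ^ p.toReal ∂μ := by
  have hs := Lp.aestronglyMeasurable s
  rw [Lp.norm_def, toReal_eLpNorm hs, lpNorm_eq_integral_norm_rpow_toReal hp0 hp hs,
    Real.rpow_inv_rpow (integral_nonneg fun t => by positivity) (ENNReal.toReal_pos hp0 hp).ne']
  rfl

/-- Differentiation under the integral: for `|r| < 1` the derivative is dominated by `p * (|s| +
|f|) ^ p`, which is integrable. -/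
theorem hasDerivAt_integral_abs_add_mul_rpow {p : ℝ≥0∞} (hp1 : 1 < p) (hp : p ≠ ∞)
    {s f : Ω → ℝ} (hs : MemLp s p μ) (hf : MemLp f p μ) :
    HasDerivAt (fun r : ℝ => ∫ t, |s t + r * f t| ^ p.toReal ∂μ)
      (∫ t, p.toReal * |s t| ^ (p.toReal - 2) * s t * f t ∂μ) 0 := by
  have hP : 1 < p.toReal := by
    rw [← ENNReal.toReal_one]
    exact ENNReal.toReal_strict_mono hp hp1
  have hp0 : p ≠ 0 := (zero_lt_one.trans hp1).ne'
  have hsm := hs.1.aemeasurable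
  have hfm := hf.1.aemeasurable
  have hint : Integrable (fun t => (|s t| + |f t|) ^ p.toReal) μ := by
    refine ((hs.abs.add hf.abs).integrable_norm_rpow hp0 hp).congr
      (Filter.Eventually.of_forall fun t => ?_)
    simp only [Pi.add_apply, Real.norm_eq_abs]
    rw [abs_of_nonneg (add_nonneg (abs_nonneg _) (abs_nonneg _))]
    rfl
  have key := hasDerivAt_integral_of_dominated_loc_of_deriv_le (μ := μ) (x₀ := (0 : ℝ))
    (s := Metric.ball (0 : ℝ) 1) (Metric.ball_mem_nhds 0 one_pos)
    (F := fun r t => |s t + r * f t| ^ p.toReal)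
    (F' := fun r t => p.toReal * |s t + r * f t| ^ (p.toReal - 2) * (s t + r * f t) * f t)
    (bound := fun t => p.toReal * (|s t| + |f t|) ^ p.toReal)
    (Filter.Eventually.of_forall fun r =>
      ((hsm.add (hfm.const_mul r)).abs.pow_const _).aestronglyMeasurable)
    (by simpa using hs.integrable_norm_rpow hp0 hp)
    (((((hsm.add (hfm.const_mul 0)).abs.pow_const _).const_mul _).mul
      (hsm.add (hfm.const_mul 0))).mul hfm).aestronglyMeasurable
    (Filter.Eventually.of_forall fun t r hr => ?_) (hint.const_mul _)
    (Filter.Eventually.of_forall fun t r _ => ?_)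
  · simpa using key.2
  · rw [mem_ball_zero_iff, Real.norm_eq_abs] at hr
    have hle : |s t + r * f t| ≤ |s t| + |f t| := by
      refine (abs_add_le _ _).trans ?_
      rw [abs_mul]
      gcongr
      exact mul_le_of_le_one_left (abs_nonneg _) hr.le
    rw [mul_assoc p.toReal, norm_mul, norm_mul, Real.norm_of_nonneg (zero_le_one.trans hP.le),
      Real.norm_eq_abs, Real.norm_eq_abs, abs_abs_rpow_mul_self hP, mul_assoc]
    refine mul_le_mul_of_nonneg_left ?_ (zero_le_one.trans hP.le)
    calc |s t + r * f t| ^ (p.toReal - 1) * |f t|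
        ≤ (|s t| + |f t|) ^ (p.toReal - 1) * (|s t| + |f t|) := by
          gcongr
          exact le_add_of_nonneg_left (abs_nonneg _)
      _ = (|s t| + |f t|) ^ p.toReal := by
          rw [← Real.rpow_add_one' (by positivity) (by linarith)]
          congr 1
          ring
  · have h1 : HasDerivAt (fun r : ℝ => s t + r * f t) (f t) r := by
      simpa using ((hasDerivAt_id r).mul_const (f t)).const_add (s t)
    exact (hasDerivAt_abs_rpow (s t + r * f t) hP).comp r h1

theorem lpDualityFun_eq {p : ℝ≥0∞} (s : Lp ℝ p μ) :
    lpDualityFun s = fun t => (‖s‖ ^ (p.toReal - 2))⁻¹ * (|s t| ^ (p.toReal - 2) * s t) := by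
  funext t
  rw [lpDualityFun, abs_rpow_mul_sign, div_eq_inv_mul]

theorem memLp_lpDualityFun {p q : ℝ≥0∞} (hp : p ≠ ∞) (hq : q ≠ ∞)
    [ENNReal.HolderConjugate p q] (s : Lp ℝ p μ) : MemLp (lpDualityFun s) q μ := by
  rw [lpDualityFun_eq]
  exact ((Lp.memLp s).abs_rpow_mul_self hp hq).const_mul _

/-- A functional in the duality mapping of `s` is integration against `lpDualityFun s`. -/
theorem apply_eq_integral_of_mem_dualityMap {p : ℝ≥0∞} [Fact (1 ≤ p)] (hp1 : 1 < p) (hp : p ≠ ∞)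
    {s : Lp ℝ p μ} {φ : StrongDual ℝ (Lp ℝ p μ)} (hφ : φ ∈ dualityMap s) (f : Lp ℝ p μ) :
    φ f = ∫ t, f t * lpDualityFun s t ∂μ := by
  have hP : 1 < p.toReal := by
    rw [← ENNReal.toReal_one]
    exact ENNReal.toReal_strict_mono hp hp1
  have hp0 : p ≠ 0 := (zero_lt_one.trans hp1).ne'
  obtain ⟨hφs, hφn⟩ := hφ
  have hn : ‖φ‖ = ‖s‖ := ((sq_eq_sq₀ (norm_nonneg _) (norm_nonneg _)).mp hφn).symm
  rcases eq_or_ne s 0 with rfl | hs0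
  · have hφ0 : φ = 0 := by simpa using hn
    have hz : (fun t => f t * lpDualityFun (0 : Lp ℝ p μ) t) =ᵐ[μ] 0 := by
      filter_upwards [Lp.coeFn_zero ℝ p μ] with t ht
      rw [lpDualityFun, ht]
      simp
    rw [integral_congr_ae hz, hφ0]
    simp
  have hN : 0 < ‖s‖ := norm_pos_iff.mpr hs0
  have hF : ∀ r : ℝ, ∫ t, |s t + r * f t| ^ p.toReal ∂μ = ‖s + r • f‖ ^ p.toReal := by
    intro r
    rw [Lp.norm_rpow_eq_integral hp0 hp]
    refine integral_congr_ae ?_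
    filter_upwards [Lp.coeFn_add s (r • f), Lp.coeFn_smul r f] with t h1 h2
    rw [h1, Pi.add_apply, h2, Pi.smul_apply, smul_eq_mul]
  have hd1 := (hasDerivAt_integral_abs_add_mul_rpow hp1 hp (Lp.memLp s) (Lp.memLp f)).const_mul
    (‖s‖ ^ p.toReal)
  have hd2 : HasDerivAt (fun r : ℝ => |φ s + r * φ f| ^ p.toReal)
      (p.toReal * |φ s| ^ (p.toReal - 2) * φ s * φ f) 0 := by
    have h1 : HasDerivAt (fun r : ℝ => φ s + r * φ f) (φ f) 0 := by
      simpa using ((hasDerivAt_id (0 : ℝ)).mul_const (φ f)).const_add (φ s)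
    have h2 := hasDerivAt_abs_rpow (φ s + 0 * φ f) hP
    simpa [Function.comp_def] using h2.comp (0 : ℝ) h1
  -- The difference is nonnegative because `‖φ‖ = ‖s‖`, and zero at `r = 0` because `φ s = ‖s‖ ^ 2`.
  have hmin : IsLocalMin (fun r : ℝ => ‖s‖ ^ p.toReal * ∫ t, |s t + r * f t| ^ p.toReal ∂μ -
      |φ s + r * φ f| ^ p.toReal) 0 := by
    refine Filter.Eventually.of_forall fun r => ?_
    simp only [hF]
    have h0 : ‖s‖ ^ p.toReal * ‖s + (0 : ℝ) • f‖ ^ p.toReal -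
        |φ s + 0 * φ f| ^ p.toReal = 0 := by
      rw [zero_smul, zero_mul, add_zero, add_zero, hφs, abs_of_nonneg (by positivity), sq,
        Real.mul_rpow hN.le hN.le, sub_self]
    have h1 : |φ s + r * φ f| ^ p.toReal ≤ ‖s‖ ^ p.toReal * ‖s + r • f‖ ^ p.toReal := by
      rw [← Real.mul_rpow hN.le (norm_nonneg _)]
      refine Real.rpow_le_rpow (abs_nonneg _) ?_ (by linarith)
      have := φ.le_opNorm (s + r • f)
      rwa [hn, map_add, map_smul, smul_eq_mul, Real.norm_eq_abs] at this
    linarith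
  have hzero := hmin.hasDerivAt_eq_zero (hd1.sub hd2)
  have hI : ∫ t, p.toReal * |s t| ^ (p.toReal - 2) * s t * f t ∂μ =
      p.toReal * ∫ t, f t * (|s t| ^ (p.toReal - 2) * s t) ∂μ := by
    rw [← integral_const_mul]
    exact integral_congr_ae (Filter.Eventually.of_forall fun t => by ring)
  have hJ : ∫ t, f t * lpDualityFun s t ∂μ =
      (‖s‖ ^ (p.toReal - 2))⁻¹ * ∫ t, f t * (|s t| ^ (p.toReal - 2) * s t) ∂μ := by
    rw [lpDualityFun_eq, ← integral_const_mul]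
    exact integral_congr_ae (Filter.Eventually.of_forall fun t => by ring)
  have hpow : ‖s‖ ^ p.toReal = ‖s‖ ^ (p.toReal - 2) * ‖s‖ ^ 2 := by
    rw [← Real.rpow_natCast, ← Real.rpow_add hN]
    congr 1
    norm_num
  have hA : 0 < ‖s‖ ^ (p.toReal - 2) := by positivity
  rw [hI, hφs, abs_of_nonneg (by positivity), sq, Real.mul_rpow hN.le hN.le, ← sq, hpow] at hzero
  rw [hJ, eq_inv_mul_iff_mul_eq₀ hA.ne']
  have hc : p.toReal * (‖s‖ ^ (p.toReal - 2) * ‖s‖ ^ 2) ≠ 0 := by positivity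
  refine mul_left_cancel₀ hc ?_
  linarith

/-- An element of `L^q` is determined by its pairing with `L^p`. -/
theorem ae_eq_of_forall_integral_mul_eq {p q : ℝ≥0∞} (hp : p ≠ ∞) (hq : q ≠ ∞)
    [ENNReal.HolderConjugate p q] {g h : Ω → ℝ} (hg : MemLp g q μ) (hh : MemLp h q μ)
    (heq : ∀ f : Lp ℝ p μ, ∫ t, f t * g t ∂μ = ∫ t, f t * h t ∂μ) : g =ᵐ[μ] h := by
  have hk : MemLp (g - h) q μ := hg.sub hh
  -- Testing against `|g - h| ^ (q - 2) * (g - h)`, which lies in `L^p`, gives `∫ |g - h| ^ q = 0`.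
  have hv := hk.abs_rpow_mul_self (p := q) (q := p) hq hp
  have hq0 : q.toReal ≠ 0 := (ENNReal.toReal_pos (ENNReal.HolderConjugate.ne_zero q p) hq).ne'
  have h0 : ∫ t, |(g - h) t| ^ q.toReal ∂μ = 0 := by
    have hf := Lp.memLp hv.toLp
    have hsub := integral_sub (hf.integrable_mul hg) (hf.integrable_mul hh)
    rw [← sub_eq_zero.mpr (heq hv.toLp)]
    refine Eq.trans ?_ hsub
    refine integral_congr_ae ?_
    filter_upwards [hv.coeFn_toLp] with t ht
    rw [Pi.mul_apply, Pi.mul_apply, ← mul_sub, ht, ← abs_rpow_mul_self_mul_self hq0, Pi.sub_apply]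
  have hint := hk.integrable_norm_rpow (ENNReal.HolderConjugate.ne_zero q p) hq
  have hae := (integral_eq_zero_iff_of_nonneg (fun t => by positivity) hint).mp h0
  filter_upwards [hae] with t ht
  simp only [Pi.zero_apply, Real.norm_eq_abs] at ht
  rw [Real.rpow_eq_zero (abs_nonneg _) hq0, abs_eq_zero, Pi.sub_apply, sub_eq_zero] at ht
  exact ht

theorem isLqRepresentation_of_mem_dualityMap {p q : ℝ≥0∞} [Fact (1 ≤ p)] (hp1 : 1 < p)
    (hp : p ≠ ∞) (hq : q ≠ ∞) [ENNReal.HolderConjugate p q] {s : Lp ℝ p μ}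
    {φ : StrongDual ℝ (Lp ℝ p μ)} (hφ : φ ∈ dualityMap s) :
    IsLqRepresentation q φ (lpDualityFun s) := by
  have hmem := memLp_lpDualityFun (q := q) hp hq s
  have happly := apply_eq_integral_of_mem_dualityMap hp1 hp hφ
  exact ⟨hmem, happly, fun g hg hgφ => ae_eq_of_forall_integral_mul_eq hp hq hg hmem fun f => by
    rw [← hgφ, ← happly]⟩

/-- A norming functional from Hahn-Banach, scaled by `‖x‖`. -/
theorem dualityMap_nonempty {X : Type*} [NormedAddCommGroup X] [NormedSpace ℝ X] (x : X) :
    (dualityMap x).Nonempty := by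
  rcases eq_or_ne x 0 with rfl | hx
  · exact ⟨0, by simp [dualityMap]⟩
  · obtain ⟨g, hg, hgx⟩ := exists_dual_vector ℝ x (norm_ne_zero_iff.mpr hx)
    refine ⟨‖x‖ • g, ?_, ?_⟩
    · simp [hgx, sq]
    · simp [norm_smul, hg]

theorem exists_dualityMap_eq_singleton {p : ℝ≥0∞} [Fact (1 ≤ p)] (hp1 : 1 < p) (hp : p ≠ ∞)
    (s : Lp ℝ p μ) : ∃ φ : StrongDual ℝ (Lp ℝ p μ), dualityMap s = {φ} := by
  obtain ⟨φ, hφ⟩ := dualityMap_nonempty s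
  refine ⟨φ, Set.eq_singleton_iff_unique_mem.mpr ⟨hφ, fun ψ hψ => ContinuousLinearMap.ext fun f => ?_⟩⟩
  rw [apply_eq_integral_of_mem_dualityMap hp1 hp hψ,
    apply_eq_integral_of_mem_dualityMap hp1 hp hφ]

end Lp

/-! ### The robust SVM theorem in `L^p` -/

theorem mainTheorem8 {Ω : Type*} [MeasurableSpace Ω] (μ : Measure Ω)
    (p q : ℝ≥0∞) [Fact (1 ≤ p)] (hp_one : 1 < p) (hp_top : p < ∞) (hpq : 1 / p + 1 / q = 1)
    (m : ℕ) (K : Fin m → Set (Lp ℝ p μ)) (y : Fin m → ℝ)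
    (hy : ∀ i, y i = 1 ∨ y i = -1)
    (hK_nonempty : ∀ i, (K i).Nonempty)
    (hK_convex : ∀ i, Convex ℝ (K i))
    (hK_compact : ∀ i, IsWeaklyCompact (K i))
    (hK_disjoint : classHull K y 1 ∩ classHull K y (-1) = ∅) :
    (∃ (w : StrongDual ℝ (Lp ℝ p μ)) (b : ℝ), IsRSVMSolution K y w b) ∧
    (∀ (w w' : StrongDual ℝ (Lp ℝ p μ)) (b b' : ℝ),
      IsRSVMSolution K y w b → IsRSVMSolution K y w' b' → w = w') ∧
    (∀ (w : StrongDual ℝ (Lp ℝ p μ)) (b : ℝ), IsRSVMSolution K y w b ↔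
      ∃ (lam : Fin m → ℝ) (x : Fin m → Lp ℝ p μ), RSVMMultipliers K y w b lam x ∧
        IsLqRepresentation q w (lpDualityFun (∑ i, (y i * lam i) • x i))) ∧
    (∀ s : Lp ℝ p μ, ∃ φ : StrongDual ℝ (Lp ℝ p μ),
      dualityMap s = {φ} ∧ IsLqRepresentation q φ (lpDualityFun s)) := by
  have hp : p ≠ ∞ := hp_top.ne
  have : ENNReal.HolderConjugate p q := ENNReal.holderConjugate_iff.mpr (by simpa using hpq)
  have hq : q ≠ ∞ := (ENNReal.HolderConjugate.ne_top_iff_ne_one q p).mpr hp_one.ne'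
  obtain ⟨hex, lam, x, hlamx⟩ := exists_isRSVMSolution_and_multipliers hy hK_nonempty hK_convex
    hK_compact hK_disjoint
  refine ⟨hex, fun w w' b b' hw hw' => ?_, fun w b => ⟨fun hw => ?_, ?_⟩, fun s => ?_⟩
  -- Both solutions lie in the duality map of the same `s`, since `lam` and `x` do not depend on the
  -- solution.
  · obtain ⟨φ, hφ⟩ := exists_dualityMap_eq_singleton hp_one hp (∑ i, (y i * lam i) • x i)
    have h := (hlamx w b hw).2
    have h' := (hlamx w' b' hw').2
    rw [hφ, Set.mem_singleton_iff] at h h'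
    rw [h, h']
  · obtain ⟨hmul, hmem⟩ := hlamx w b hw
    exact ⟨lam, x, hmul, isLqRepresentation_of_mem_dualityMap hp_one hp hq hmem⟩
  · rintro ⟨lam', x', hmul, hrep⟩
    -- Some `φ` in the duality map has the same integral formula as `w`, hence equals `w`.
    obtain ⟨φ, hφ⟩ := dualityMap_nonempty (∑ i, (y i * lam' i) • x' i)
    have hwφ : w = φ := ContinuousLinearMap.ext fun f => by
      rw [hrep.2.1 f, apply_eq_integral_of_mem_dualityMap hp_one hp hφ]
    exact hmul.isRSVMSolution (hwφ ▸ hφ)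
  · obtain ⟨φ, hφ⟩ := exists_dualityMap_eq_singleton hp_one hp s
    exact ⟨φ, hφ, isLqRepresentation_of_mem_dualityMap hp_one hp hq (hφ ▸ Set.mem_singleton φ)⟩
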